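/- Let $T$ be a split torus over $\mathbb{R}$, i.e. $T=\operatorname{Spec}\mathbb{R}[M]$ for a free abelian group $M$ of finite rank. Let $U$ be a toric variety for $T$, that is, a normal variety over $\mathbb{R}$ (an integral, normal, separated scheme of finite type over $\mathbb{R}$) with an action of $T$ and a $T$-equivariant open embedding $T\hookrightarrow U$. For a Weil divisor $D$ on $U$ (an integer combination of finitely many prime divisors, not necessarily torus-invariant) let $$H^0(U,\mathcal{O}_U(D))=\{f\in\mathbb{R}(U)^*:\operatorname{div}(f)+D\ge 0\}\cup\{0\}.$$ Then for every Weil divisor $D$ on $U$ the space $H^0(U,\mathcal{O}_U(D))$ is finitely generated as a module over the ring $\mathcal{O}(U)=H^0(U,\mathcal{O}_U)$ of global regular functions. -/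

import Mathlib

open CategoryTheory AlgebraicGeometry

universe u

/-! ## Normal schemes -/

/-- A scheme is normal if all its local rings are integrally closed domains. -/
class IsNormalScheme (X : Scheme.{u}) : Prop where
  isDomain_stalk (x : X) : IsDomain (X.presheaf.stalk x)
  isIntegrallyClosed_stalk (x : X) : IsIntegrallyClosed (X.presheaf.stalk x)

/-- The local ring of a normal locally Noetherian integral scheme at a point of codimension one
is a discrete valuation ring. -/
theorem isDiscreteValuationRing_stalk (X : Scheme.{u}) [IsIntegral X] [IsLocallyNoetherian X]
    [IsNormalScheme X] (x : X) (hx : Order.coheight x = 1) :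
    IsDiscreteValuationRing (X.presheaf.stalk x) := by
  have hdim : ringKrullDim (X.presheaf.stalk x) = 1 := by
    rw [ringKrullDim_stalk_eq_coheight, hx]; rfl
  have h1 : Ring.KrullDimLE 1 (X.presheaf.stalk x) :=
    krullDimLE_of_coheight_le (n := 1) hx.le
  have hf : ¬ IsField (X.presheaf.stalk x) := by
    intro h
    rw [ringKrullDim_eq_zero_of_isField h] at hdim
    exact absurd hdim (by norm_num)
  have : IsIntegrallyClosed (X.presheaf.stalk x) := IsNormalScheme.isIntegrallyClosed_stalk x
  have h2 : Ring.DimensionLEOne (X.presheaf.stalk x) :=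
    ⟨fun {p} hp hp' => Ring.krullDimLE_one_iff_of_isPrime_bot.1 h1 p hp hp'⟩
  have h3 : IsDedekindDomain (X.presheaf.stalk x) := { }
  exact ((IsDiscreteValuationRing.TFAE (X.presheaf.stalk x) hf).out 0 2).2 h3

/-! ## Weil divisors and their sections -/

/-- The prime divisors of a scheme, each given by its generic point, that is,
by a point of codimension one (`Order.coheight` is taken in the specialization order). -/
abbrev PrimeDivisor (X : Scheme.{u}) : Type u := {x : X // Order.coheight x = 1}

/-- Weil divisors: the free abelian group on the prime divisors. -/
abbrev WeilDivisor (X : Scheme.{u}) : Type u := PrimeDivisor X →₀ ℤ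

namespace WeilDivisor

variable {X : Scheme.{u}} [IsIntegral X] [IsLocallyNoetherian X] [IsNormalScheme X]

/-- The sections of the sheaf `𝒪_X(D)` over a non-empty open set `V`: zero, and the non-zero
rational functions `f` for which the restriction of `div f + D` to `V` is effective.
They form a module over the ring of regular functions on `V`. -/
noncomputable def sections (D : WeilDivisor X) (V : X.Opens) [Nonempty V] :
    Submodule Γ(X, V) X.functionField where
  carrier := {f | f ≠ 0 → ∀ P : PrimeDivisor X, P.1 ∈ V → 0 ≤ Scheme.ord f P.1 + D P}
  zero_mem' := fun h => absurd rfl h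
  add_mem' := by
    intro f g hf hg hfg P hP
    by_cases h1 : f = 0
    · subst h1
      simpa using hg (by simpa using hfg) P hP
    by_cases h2 : g = 0
    · subst h2
      simpa using hf h1 P hP
    have := isDiscreteValuationRing_stalk X P.1 P.2
    have h := Scheme.ord_add (x := P.1) hfg
    have h3 := hf h1 P hP
    have h4 := hg h2 P hP
    rcases min_le_iff.1 h with h | h <;> linarith
  smul_mem' := by
    intro a f hf haf P hP
    have ha : a ≠ 0 := by rintro rfl; simp at haf
    have h1 : f ≠ 0 := by rintro rfl; simp at haf
    have h := Scheme.ord_le_smul (x := P.1) hP ha f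
    have h3 := hf h1 P hP
    linarith

instance : Nonempty (⊤ : X.Opens) := ⟨⟨genericPoint X, trivial⟩⟩

/-- The module `H⁰(X, 𝒪_X(D))` of global sections of `𝒪_X(D)` over `H⁰(X, 𝒪_X)`. -/
noncomputable abbrev H0 (D : WeilDivisor X) : Submodule Γ(X, ⊤) X.functionField :=
  D.sections ⊤

end WeilDivisor

/-! ## Toric varieties -/

/-- The split torus `Spec k[M]` over `k` with character group `M`. Its group structure is the one
given by the Hopf algebra structure of the group algebra `k[M]`, all characters being
group-like. -/
noncomputable abbrev splitTorus (k M : Type u) [Field k] [AddCommGroup M] :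
    Over (Spec (.of k)) :=
  (Spec (.of (AddMonoidAlgebra k M))).asOver (Spec (.of k))

/-- A (normal) toric variety over `k` for the split torus `T` with character lattice `M`: a normal
variety over `k` (an integral separated scheme of finite type over `k`) with an action of `T` and
a `T`-equivariant open immersion of `T` into it. The image of `T` is dense because the variety is
irreducible. -/
structure ToricVariety (k M : Type u) [Field k] [AddCommGroup M] [Module.Free ℤ M]
    [Module.Finite ℤ M] where
  /-- The underlying scheme over `k`. -/
  X : Over (Spec (.of k))
  isIntegral : IsIntegral X.left
  isNormal : IsNormalScheme X.left
  isSeparated : IsSeparated X.hom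
  locallyOfFiniteType : LocallyOfFiniteType X.hom
  quasiCompact : QuasiCompact X.hom
  /-- The action of the torus. -/
  action : ModObj (splitTorus k M) X
  /-- The embedding of the torus. -/
  torusEmb : splitTorus k M ⟶ X
  isOpenImmersion_torusEmb : IsOpenImmersion torusEmb.left
  /-- The embedding is equivariant: the action extends the multiplication of the torus. -/
  equivariant :
    letI := ModObj.regular (splitTorus k M)
    IsModHom (splitTorus k M) torusEmb

namespace ToricVariety

variable {k M : Type u} [Field k] [AddCommGroup M] [Module.Free ℤ M] [Module.Finite ℤ M]

/-- The underlying scheme of a toric variety. -/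
noncomputable abbrev scheme (U : ToricVariety k M) : Scheme.{u} := U.X.left

instance (U : ToricVariety k M) : IsIntegral U.scheme := U.isIntegral

instance (U : ToricVariety k M) : IsNormalScheme U.scheme := U.isNormal

instance (U : ToricVariety k M) : IsLocallyNoetherian U.scheme :=
  haveI := U.locallyOfFiniteType
  LocallyOfFiniteType.isLocallyNoetherian U.X.hom

end ToricVariety

/-!
Write `T` for the torus, `M` for its character lattice and `k` for the ground field. The coordinate
ring `k[M]` of `T` is factorial, so that every Weil divisor on the toric variety `U` is linearly
equivalent to a divisor `D` supported on the boundary `U ∖ T` (`ToricVariety.exists_ord_eq`). As `U`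
is normal, Hartogs' lemma (`AlgebraicGeometry.Scheme.mem_range_germToFunctionField`) shows that
`H⁰(U, 𝒪(D))` consists of the `f ∈ k[M]` whose order along each boundary divisor `E` is at
least `-D(E)`, and likewise that `𝒪(U)` consists of the `f ∈ k[M]` without poles on the boundary.

The space `H⁰(U, 𝒪(D))` is spanned by characters (`ToricVariety.single_mem_laurentH0`). A rational
point of `T` acts on `U` by an automorphism that permutes the boundary divisors. There are finitely
many of these, so that a power of the automorphism fixes them all and hence preserves
`H⁰(U, 𝒪(D))`. On `k[M]` it acts diagonally, `χ^m` being an eigenvector with eigenvalue the value of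
`χ^m` at the point. Over `ℝ` there is a point at which all characters take different values, and so do
their powers: send `m` to `exp (θ m)` for an injective homomorphism `θ : M → ℝ`. A subspace
preserved by such a diagonal operator is graded. This replaces the torus-invariant affine charts of
Sumihiro's theorem, which are not needed.

The characters `χ^m` in `H⁰(U, 𝒪(D))` are those with `ord_E χ^m ≥ -D(E)` for all `E`. By Dickson's
lemma (`exists_finset_forall_exists_le`) there are finitely many among them, `χ^{m₀}`, such that each
`χ^m` in the space satisfies `ord_E χ^m ≥ ord_E χ^{m₀}` for one of them and all `E`. Then `χ^(m - m₀)`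
is a regular function on `U`, so that these finitely many characters generate
(`ToricVariety.fg_H0_of_forall_mem_torus`).
-/

/-! ### Commutative algebra and lattices -/

/-- A Noetherian integrally closed domain is the intersection of its localizations at the primes of
height one. The hypothesis says that `x` lies in each of these localizations, without naming them.
If `x` were not in `A`, an associated prime of the submodule of `K / A` generated by `x` would
have height one. -/
theorem mem_range_algebraMap_of_forall_height_eq_one {A K : Type*} [CommRing A] [IsDomain A]
    [IsNoetherianRing A] [IsIntegrallyClosed A] [Field K] [Algebra A K] [IsFractionRing A K]
    (x : K) (h : ∀ p : Ideal A, p.IsPrime → p.height = 1 →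
      ∃ s ∉ p, algebraMap A K s * x ∈ (algebraMap A K).range) :
    x ∈ (algebraMap A K).range := by
  by_contra hx
  let I : A → Ideal A := fun c =>
    { carrier := {r | algebraMap A K (r * c) * x ∈ (algebraMap A K).range}
      zero_mem' := by simp
      add_mem' := by
        intro r s hr hs
        simp only [Set.mem_ofPred_eq, add_mul, map_add] at hr hs ⊢
        exact add_mem hr hs
      smul_mem' := by
        intro r s hs
        simp only [Set.mem_ofPred_eq, smul_eq_mul] at hs ⊢
        rw [mul_assoc, map_mul, mul_assoc]
        exact mul_mem ⟨r, rfl⟩ hs }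
  have hI : ∀ c r, r ∈ I c ↔ algebraMap A K (r * c) * x ∈ (algebraMap A K).range :=
    fun c r => Iff.rfl
  -- `I c` is the annihilator of the class of `c * x` in `K / A`; a maximal one among the proper
  -- annihilators is an associated prime.
  obtain ⟨_, ⟨c, hc, rfl⟩, hmax⟩ := set_has_maximal_iff_noetherian.2 ‹IsNoetherianRing A›
    {J | ∃ c, algebraMap A K c * x ∉ (algebraMap A K).range ∧ J = I c}
    ⟨I 1, 1, by simpa using hx, rfl⟩
  have hprime : (I c).IsPrime := by
    refine ⟨?_, ?_⟩
    · rw [Ideal.ne_top_iff_one, hI]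
      simpa using hc
    · intro r s hrs
      by_contra! hcon
      obtain ⟨hr, hs⟩ := hcon
      have hsc : algebraMap A K (s * c) * x ∉ (algebraMap A K).range := hs
      have hle : I c ≤ I (s * c) := by
        intro t ht
        rw [hI] at ht ⊢
        have := mul_mem (⟨s, rfl⟩ : algebraMap A K s ∈ (algebraMap A K).range) ht
        rw [← mul_assoc, ← map_mul] at this
        convert this using 3
        ring
      have hlt : I c < I (s * c) := by
        refine lt_of_le_of_ne hle fun heq => hr ?_
        rw [heq, hI, ← mul_assoc]
        exact hrs
      exact hmax _ ⟨s * c, hsc, rfl⟩ hlt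
  have hbot : I c ≠ ⊥ := by
    obtain ⟨a, b, hb, hab⟩ := IsFractionRing.div_surjective (A := A) x
    have hb0 : algebraMap A K b ≠ 0 := by simpa using nonZeroDivisors.ne_zero hb
    intro hbot
    have : b ∈ I c := by
      rw [hI, ← hab]
      refine ⟨c * a, ?_⟩
      rw [map_mul, map_mul]
      field_simp
    rw [hbot] at this
    exact nonZeroDivisors.ne_zero hb this
  set y := algebraMap A K c * x with hy
  have hIy : ∀ r, r ∈ I c ↔ algebraMap A K r * y ∈ (algebraMap A K).range := by
    intro r
    rw [hI, hy, map_mul, mul_assoc]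
  have hex : ∃ r ∈ I c, ∃ u ∉ I c, algebraMap A K r * y = algebraMap A K u := by
    by_contra! hcon
    -- Otherwise multiplication by `y` preserves the prime `I c`, so that `y` is integral over `A`.
    refine hc (IsIntegrallyClosed.isIntegral_iff.1 ?_)
    let N : Submodule A K := Submodule.map (Algebra.linearMap A K) (I c)
    refine isIntegral_of_smul_mem_submodule (N := N) ?_ ?_ y ?_
    · intro hN
      obtain ⟨b, hb, hb0⟩ := Submodule.exists_mem_ne_zero_of_ne_bot hbot
      have hbN : algebraMap A K b ∈ N := ⟨b, hb, rfl⟩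
      rw [hN, Submodule.mem_bot] at hbN
      exact hb0 (by simpa using hbN)
    · exact (IsNoetherian.noetherian (I c)).map _
    · rintro _ ⟨r, hr, rfl⟩
      obtain ⟨u, hu⟩ := (hIy r).1 hr
      have : u ∈ I c := by
        by_contra hu'
        exact hcon r hr u hu' hu.symm
      refine ⟨u, this, ?_⟩
      simp only [Algebra.linearMap_apply, hu, smul_eq_mul, mul_comm]
  obtain ⟨r, hr, u, hu, hru⟩ := hex
  have hheight : (I c).height = 1 := by
    refine le_antisymm ?_ ?_
    -- Krull: `u * s = (s * y) * r` for `s` in the prime, so that it is minimal over `r`.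
    · refine Ideal.height_le_one_of_isPrincipal_of_mem_minimalPrimes (Ideal.span {r}) _
        ⟨⟨hprime, by simpa using hr⟩, ?_⟩
      rintro q ⟨hq, hrq⟩ hqp s hs
      obtain ⟨t, ht⟩ := (hIy s).1 hs
      have hsu : s * u = t * r := by
        apply IsFractionRing.injective A K
        rw [map_mul, map_mul, ht, ← hru]
        ring
      have : s * u ∈ q := by
        rw [hsu]
        exact q.mul_mem_left _ (hrq (Ideal.mem_span_singleton_self r))
      exact (hq.mem_or_mem this).resolve_right fun h => hu (hqp h)
    · rw [Order.one_le_iff_pos, pos_iff_ne_zero, Ne, Ideal.height_eq_zero_iff]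
      intro h0
      exact hbot (by simpa [IsDomain.minimalPrimes_eq_singleton_bot] using h0)
  obtain ⟨s, hs, hsx⟩ := h _ hprime hheight
  refine hs ((hIy s).2 ?_)
  rw [hy, mul_left_comm]
  exact mul_mem ⟨c, rfl⟩ hsx

namespace AddMonoidAlgebra

/-- By induction on the rank: `k[ℤⁿ⁺¹]` is the ring of Laurent polynomials over `k[ℤⁿ]`, a localization
of a polynomial ring. -/
theorem isDomain_and_uniqueFactorizationMonoid_pi_int (k : Type*) [Field k] (n : ℕ) :
    ∃ _ : IsDomain (AddMonoidAlgebra k (Fin n → ℤ)),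
      UniqueFactorizationMonoid (AddMonoidAlgebra k (Fin n → ℤ)) := by
  induction n with
  | zero =>
    let e : AddMonoidAlgebra k (Fin 0 → ℤ) ≃+* k := AddMonoidAlgebra.uniqueRingEquiv _
    have := e.toMulEquiv.isDomain k
    exact ⟨this, e.symm.toMulEquiv.uniqueFactorizationMonoid inferInstance⟩
  | succ n ih =>
    obtain ⟨_, _⟩ := ih
    let R := AddMonoidAlgebra k (Fin n → ℤ)
    let e₁ : (Fin (n + 1) → ℤ) ≃+ ℤ × (Fin n → ℤ) :=
      (Fin.consLinearEquiv ℤ (fun _ : Fin (n + 1) => ℤ)).symm.toAddEquiv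
    let e : AddMonoidAlgebra k (Fin (n + 1) → ℤ) ≃+* LaurentPolynomial R :=
      (AddMonoidAlgebra.domCongr k k e₁).toRingEquiv.trans AddMonoidAlgebra.curryRingEquiv
    have : IsDomain (LaurentPolynomial R) :=
      IsLocalization.Away.isDomain (x := (Polynomial.X : Polynomial R)) _ Polynomial.X_ne_zero
    have : UniqueFactorizationMonoid (LaurentPolynomial R) :=
      .of_isLocalization (Submonoid.powers (Polynomial.X : Polynomial R)) _
    have h := e.toMulEquiv.isDomain (LaurentPolynomial R)
    exact ⟨h, e.symm.toMulEquiv.uniqueFactorizationMonoid inferInstance⟩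

instance isDomain_of_free (k M : Type*) [Field k] [AddCommGroup M]
    [Module.Free ℤ M] [Module.Finite ℤ M] : IsDomain (AddMonoidAlgebra k M) := by
  obtain ⟨_, _⟩ := isDomain_and_uniqueFactorizationMonoid_pi_int k (Module.finrank ℤ M)
  let e := AddMonoidAlgebra.domCongr k k (Module.finBasis ℤ M).equivFun.toAddEquiv
  exact e.toMulEquiv.isDomain _

instance uniqueFactorizationMonoid_of_free (k M : Type*) [Field k] [AddCommGroup M]
    [Module.Free ℤ M] [Module.Finite ℤ M] :
    UniqueFactorizationMonoid (AddMonoidAlgebra k M) := by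
  obtain ⟨_, _⟩ := isDomain_and_uniqueFactorizationMonoid_pi_int k (Module.finrank ℤ M)
  let e := AddMonoidAlgebra.domCongr k k (Module.finBasis ℤ M).equivFun.toAddEquiv
  exact e.symm.toMulEquiv.uniqueFactorizationMonoid inferInstance

end AddMonoidAlgebra

/-- A subspace stable under an endomorphism contains, along with a sum of eigenvectors for distinct
eigenvalues, each of the summands. -/
theorem Submodule.mem_of_sum_mem_of_eigenvectors {k V ι : Type*} [Field k] [AddCommGroup V]
    [Module k V] (N : Submodule k V) (σ : V →ₗ[k] V) (hσ : ∀ x ∈ N, σ x ∈ N) (μ : ι → k)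
    (hμ : Function.Injective μ) (s : Finset ι) : ∀ (x : ι → V) (_ : ∀ i, σ (x i) = μ i • x i)
    (_ : ∑ i ∈ s, x i ∈ N), ∀ i ∈ s, x i ∈ N := by
  classical
  induction s using Finset.induction_on with
  | empty => simp
  | insert i₀ s hi₀ ih =>
    intro x hx hs
    have key : ∀ i ∈ s, x i ∈ N := by
      have h1 : ∑ i ∈ s, (μ i - μ i₀) • x i ∈ N := by
        have h2 := N.sub_mem (hσ _ hs) (N.smul_mem (μ i₀) hs)
        rw [map_sum, Finset.smul_sum, ← Finset.sum_sub_distrib, Finset.sum_insert hi₀] at h2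
        simpa only [hx, ← sub_smul, sub_self, zero_smul, zero_add] using h2
      have h3 := ih (fun i => (μ i - μ i₀) • x i)
        (fun i => by rw [map_smul, hx, smul_comm]) h1
      intro i hi
      refine (N.smul_mem_iff (sub_ne_zero.2 fun h => hi₀ ?_)).1 (h3 i hi)
      rwa [← hμ h]
    intro i hi
    rcases Finset.mem_insert.1 hi with rfl | hi
    · rw [Finset.sum_insert hi₀] at hs
      exact (N.add_mem_iff_left (N.sum_mem key)).1 hs
    · exact key i hi

/-- Dickson's lemma: a set on which finitely many integer-valued functions are bounded below has a
finite subset `F` such that each of its points dominates a point of `F` in all these functions. -/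
theorem exists_finset_forall_exists_le {M ι : Type*} [Finite ι] (l : M → ι → ℤ) (P : Set M)
    (a : ι → ℤ) (hP : ∀ m ∈ P, ∀ i, a i ≤ l m i) :
    ∃ F : Finset M, ↑F ⊆ P ∧ ∀ m ∈ P, ∃ m₀ ∈ F, l m₀ ≤ l m := by
  classical
  let g : M → ι → ℕ := fun m i => (l m i - a i).toNat
  have hg : ∀ m ∈ P, ∀ m' ∈ P, g m ≤ g m' → l m ≤ l m' := by
    intro m hm m' hm' h i
    have h1 := h i
    have h2 := hP m hm i
    have h3 := hP m' hm' i
    simp only [g] at h1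
    change l m i ≤ l m' i
    omega
  let S : Set (ι → ℕ) := {x | Minimal (· ∈ g '' P) x}
  have hS : S.Finite := WellQuasiOrderedLE.finite_of_isAntichain (setOfPred_minimal_antichain _)
  have hSP : ∀ x : S, ∃ m ∈ P, g m = x := fun x => x.2.1
  choose c hcP hc using hSP
  have := hS.fintype
  refine ⟨Finset.univ.image c, ?_, ?_⟩
  · intro m hm
    obtain ⟨x, -, rfl⟩ := Finset.mem_image.1 (Finset.mem_coe.1 hm)
    exact hcP x
  · intro m hm
    obtain ⟨x, hx, hxmin⟩ := exists_minimal_le_of_wellFoundedLT (· ∈ g '' P) (g m) ⟨m, hm, rfl⟩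
    refine ⟨c ⟨x, hxmin⟩, Finset.mem_image_of_mem _ (Finset.mem_univ _), ?_⟩
    refine hg _ (hcP _) _ hm ?_
    rw [hc]
    exact hx

/-- A lattice embeds in `ℝ`, since the dimension of `ℝ` over `ℚ` is infinite. -/
theorem exists_injective_addMonoidHom_real (M : Type*) [AddCommGroup M] [Module.Free ℤ M]
    [Module.Finite ℤ M] : ∃ θ : M →+ ℝ, Function.Injective θ := by
  have h1 : (Module.finrank ℤ M : Cardinal) ≤ Module.rank ℚ ℝ := by
    rw [Real.rank_rat_real]
    exact (Cardinal.nat_lt_continuum _).le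
  obtain ⟨s, hs, hs'⟩ := le_rank_iff_exists_linearIndependent.1 h1
  obtain ⟨e⟩ : Nonempty (Fin (Module.finrank ℤ M) ≃ s) := by
    rw [← Cardinal.eq, hs]; simp
  have h2 : LinearIndependent ℤ (fun i => ((e i : s) : ℝ)) :=
    (hs'.restrict_scalars' ℤ).comp e e.injective
  let θ : M →ₗ[ℤ] ℝ := (Module.finBasis ℤ M).constr ℤ (fun i => ((e i : s) : ℝ))
  refine ⟨θ.toAddMonoidHom, ?_⟩
  exact (Module.finBasis ℤ M).injective_constr_of_linearIndependent (R₂ := ℤ) h2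

/-! ### Orders of vanishing, rational functions and Hartogs' lemma -/

namespace AlgebraicGeometry.Scheme

section Ord

variable {X : Scheme.{u}} [IsIntegral X] [IsLocallyNoetherian X]

theorem ord_algebraMap_of_isUnit (x : X) {s : X.presheaf.stalk x} (hs : IsUnit s) :
    ord (algebraMap (X.presheaf.stalk x) X.functionField s) x = 0 := by
  by_cases hx : Order.coheight x = 1
  · rw [ord_eq_iff hx (hs.map _).ne_zero]
    have : Ring.KrullDimLE 1 (X.presheaf.stalk x) := krullDimLE_of_coheight_le hx.le
    exact Ring.ordFrac_of_isUnit hs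
  · simp [hx]

theorem ord_algebraMap_of_irreducible {x : X} (hx : Order.coheight x = 1)
    [IsDiscreteValuationRing (X.presheaf.stalk x)] {s : X.presheaf.stalk x}
    (hs : Irreducible s) :
    ord (algebraMap (X.presheaf.stalk x) X.functionField s) x = 1 := by
  rw [ord_eq_iff hx (by simpa using hs.ne_zero)]
  have : Ring.KrullDimLE 1 (X.presheaf.stalk x) := krullDimLE_of_coheight_le hx.le
  exact Ring.ordFrac_irreducible hs

@[simp]
theorem ord_one (x : X) : ord (1 : X.functionField) x = 0 := by
  simpa using ord_algebraMap_of_isUnit x (isUnit_one (M := X.presheaf.stalk x))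

theorem ord_inv (x : X) (f : X.functionField) : ord f⁻¹ x = -ord f x := by
  by_cases hf : f = 0
  · simp [hf]
  · have := ord_mul (x := x) hf (inv_ne_zero hf)
    rw [mul_inv_cancel₀ hf, ord_one] at this
    omega

theorem ord_zpow (x : X) {f : X.functionField} (hf : f ≠ 0) (n : ℤ) :
    ord (f ^ n) x = n * ord f x := by
  induction n with
  | zero => simp
  | succ n ih => rw [zpow_add_one₀ hf, ord_mul (zpow_ne_zero _ hf) hf, ih]; ring
  | pred n ih =>
    rw [zpow_sub_one₀ hf, ord_mul (zpow_ne_zero _ hf) (inv_ne_zero hf), ih, ord_inv]; ring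

theorem ord_prod {ι : Type*} (x : X) (s : Finset ι) (f : ι → X.functionField)
    (hf : ∀ i ∈ s, f i ≠ 0) : ord (∏ i ∈ s, f i) x = ∑ i ∈ s, ord (f i) x := by
  classical
  induction s using Finset.induction_on with
  | empty => simp
  | insert i s hi ih =>
    rw [Finset.prod_insert hi, Finset.sum_insert hi, ord_mul (hf i (by simp))
      (Finset.prod_ne_zero_iff.2 fun j hj => hf j (by simp [hj])),
      ih fun j hj => hf j (by simp [hj])]

/-- A characterization of the order of vanishing that makes sense after transport along an isomorphism:
it is the exponent of a uniformizer in a factorization. -/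
theorem exists_eq_unit_mul_zpow {x : X} (hx : Order.coheight x = 1)
    [IsDiscreteValuationRing (X.presheaf.stalk x)] {f : X.functionField} (hf : f ≠ 0) :
    ∃ u t : X.presheaf.stalk x, IsUnit u ∧ Irreducible t ∧
      f = algebraMap _ X.functionField u * algebraMap _ X.functionField t ^ ord f x := by
  obtain ⟨t, ht⟩ := IsDiscreteValuationRing.exists_irreducible (X.presheaf.stalk x)
  have ht0 : algebraMap _ X.functionField t ≠ 0 := by simpa using ht.ne_zero
  obtain ⟨n, u, hu⟩ : ∃ (n : ℤ) (u : (X.presheaf.stalk x)ˣ),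
      f = algebraMap _ X.functionField (u : X.presheaf.stalk x) *
        algebraMap _ X.functionField t ^ n := by
    obtain ⟨a, b, hb, rfl⟩ := IsFractionRing.div_surjective (A := X.presheaf.stalk x) f
    have hb0 := nonZeroDivisors.ne_zero hb
    have ha0 : a ≠ 0 := by rintro rfl; simp at hf
    obtain ⟨n, u, rfl⟩ := IsDiscreteValuationRing.eq_unit_mul_pow_irreducible ha0 ht
    obtain ⟨m, v, rfl⟩ := IsDiscreteValuationRing.eq_unit_mul_pow_irreducible hb0 ht
    refine ⟨n - m, u * v⁻¹, ?_⟩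
    have hv : algebraMap _ X.functionField (v : X.presheaf.stalk x) ≠ 0 := by simp
    have hv' : algebraMap (X.presheaf.stalk x) X.functionField ((v⁻¹ : (X.presheaf.stalk x)ˣ) : _)
        = (algebraMap _ X.functionField (v : X.presheaf.stalk x))⁻¹ := by
      refine eq_inv_of_mul_eq_one_left ?_
      rw [← map_mul, Units.inv_mul, map_one]
    rw [zpow_sub₀ ht0, Units.val_mul, map_mul, map_mul, map_mul, map_pow, map_pow, hv',
      zpow_natCast, zpow_natCast]
    field_simp
  have hn : ord f x = n := by
    have hu0 : algebraMap _ X.functionField (u : X.presheaf.stalk x) ≠ 0 := by simp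
    rw [hu, ord_mul hu0 (zpow_ne_zero _ ht0), ord_zpow x ht0,
      ord_algebraMap_of_isUnit x u.isUnit, ord_algebraMap_of_irreducible hx ht]
    simp
  exact ⟨u, t, u.isUnit, ht, by rwa [hn]⟩

theorem zero_le_ord_algebraMap {x : X} (hx : Order.coheight x = 1)
    [IsDiscreteValuationRing (X.presheaf.stalk x)] (s : X.presheaf.stalk x) :
    0 ≤ ord (algebraMap _ X.functionField s) x := by
  by_cases hs : s = 0
  · simp [hs]
  obtain ⟨t, ht⟩ := IsDiscreteValuationRing.exists_irreducible (X.presheaf.stalk x)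
  have ht0 : algebraMap _ X.functionField t ≠ 0 := by simpa using ht.ne_zero
  obtain ⟨n, u, rfl⟩ := IsDiscreteValuationRing.eq_unit_mul_pow_irreducible hs ht
  rw [map_mul, map_pow, ord_mul (by simp) (pow_ne_zero _ ht0),
    ord_algebraMap_of_isUnit x u.isUnit, ← zpow_natCast, ord_zpow x ht0,
    ord_algebraMap_of_irreducible hx ht]
  simp

theorem mem_range_algebraMap_of_zero_le_ord {x : X} (hx : Order.coheight x = 1)
    [IsDiscreteValuationRing (X.presheaf.stalk x)] {f : X.functionField} (hf : f ≠ 0)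
    (h : 0 ≤ ord f x) : f ∈ (algebraMap (X.presheaf.stalk x) X.functionField).range := by
  obtain ⟨u, t, -, -, hf'⟩ := exists_eq_unit_mul_zpow hx hf
  refine ⟨u * t ^ (ord f x).toNat, ?_⟩
  rw [map_mul, map_pow]
  conv_rhs => rw [hf']
  rw [← zpow_natCast, Int.toNat_of_nonneg h]

end Ord

section FunctionFieldMap

variable {X Y Z : Scheme.{u}} [IsIntegral X] [IsIntegral Y] [IsIntegral Z]

/-- The pullback of rational functions along a dominant morphism of integral schemes. Dominance is
encoded as an equation of generic points. -/
noncomputable def Hom.functionFieldMap (f : Y ⟶ X) (h : f (genericPoint Y) = genericPoint X) :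
    X.functionField →+* Y.functionField :=
  (X.presheaf.stalkSpecializes (specializes_of_eq h) ≫ f.stalkMap (genericPoint Y)).hom

theorem Hom.functionFieldMap_algebraMap (f : Y ⟶ X) (h : f (genericPoint Y) = genericPoint X)
    (y : Y) (s : X.presheaf.stalk (f y)) :
    f.functionFieldMap h (algebraMap _ X.functionField s) =
      algebraMap _ Y.functionField (f.stalkMap y s) := by
  have := stalkSpecializes_stalkMap f (genericPoint Y) y (genericPoint_specializes y)
  simp only [functionFieldMap, RingHom.algebraMap_toAlgebra]
  rw [← ConcreteCategory.comp_apply (f.stalkMap y), ← this]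
  simp only [← RingHom.comp_apply, ← CommRingCat.hom_comp]
  rw [← Category.assoc, X.presheaf.stalkSpecializes_comp]

theorem Hom.functionFieldMap_germ (f : Y ⟶ X) (h : f (genericPoint Y) = genericPoint X)
    (W : X.Opens) [Nonempty W] [Nonempty (f ⁻¹ᵁ W)] (s : Γ(X, W)) :
    f.functionFieldMap h (X.germToFunctionField W s) =
      Y.germToFunctionField (f ⁻¹ᵁ W) (f.app W s) := by
  obtain ⟨y, hy⟩ := ‹Nonempty (f ⁻¹ᵁ W)›
  have hy' : f y ∈ W := hy
  rw [← algebraMap_germ_eq_germToFunctionField X (x := f y) hy', functionFieldMap_algebraMap,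
    germ_stalkMap_apply f W y hy']
  exact algebraMap_germ_eq_germToFunctionField Y hy _

theorem Hom.functionFieldMap_comp (f : Z ⟶ Y) (g : Y ⟶ X)
    (hf : f (genericPoint Z) = genericPoint Y) (hg : g (genericPoint Y) = genericPoint X)
    (hfg : (f ≫ g) (genericPoint Z) = genericPoint X) (s : X.functionField) :
    (f ≫ g).functionFieldMap hfg s = f.functionFieldMap hf (g.functionFieldMap hg s) := by
  obtain ⟨W, hW, s, rfl⟩ := X.presheaf.exists_germ_eq s
  have : Nonempty W := ⟨⟨_, hW⟩⟩
  have : Nonempty (g ⁻¹ᵁ W) := ⟨⟨genericPoint Y, show g (genericPoint Y) ∈ W by rwa [hg]⟩⟩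
  have : Nonempty (f ⁻¹ᵁ (g ⁻¹ᵁ W)) :=
    ⟨⟨genericPoint Z, show g (f (genericPoint Z)) ∈ W by rwa [hf, hg]⟩⟩
  have : Nonempty ((f ≫ g) ⁻¹ᵁ W) := this
  rw [functionFieldMap_germ, functionFieldMap_germ, functionFieldMap_germ, Scheme.Hom.comp_app]
  rfl

/-- Orders of vanishing are compatible with pullback along open immersions, in particular along
isomorphisms. -/
theorem Hom.ord_functionFieldMap [IsLocallyNoetherian X] [IsLocallyNoetherian Y]
    [IsNormalScheme X] [IsNormalScheme Y] (f : Y ⟶ X)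
    [IsOpenImmersion f] (h : f (genericPoint Y) = genericPoint X) (s : X.functionField) (y : Y) :
    ord (f.functionFieldMap h s) y = ord s (f y) := by
  have hco : Order.coheight (f y) = Order.coheight y := coheight_eq_of_isOpenImmersion f
  by_cases hy : Order.coheight y = 1
  · have hfy : Order.coheight (f y) = 1 := hco.trans hy
    have := isDiscreteValuationRing_stalk X _ hfy
    have := isDiscreteValuationRing_stalk Y _ hy
    by_cases hs : s = 0
    · simp [hs]
    obtain ⟨u, t, hu, ht, hs'⟩ := exists_eq_unit_mul_zpow hfy hs
    have hu' : IsUnit (f.stalkMap y u) := hu.map _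
    have ht' : Irreducible (f.stalkMap y t) :=
      (MulEquiv.irreducible_iff (asIso (f.stalkMap y)).commRingCatIsoToRingEquiv).2 ht
    have ht0 : algebraMap _ Y.functionField (f.stalkMap y t) ≠ 0 := by
      simpa only [ne_eq, FaithfulSMul.algebraMap_eq_zero_iff] using ht'.ne_zero
    have hu0 : algebraMap _ Y.functionField (f.stalkMap y u) ≠ 0 := (hu'.map _).ne_zero
    conv_lhs => rw [hs']
    rw [map_mul, map_zpow₀, functionFieldMap_algebraMap, functionFieldMap_algebraMap,
      ord_mul hu0 (zpow_ne_zero _ ht0), ord_zpow _ ht0, ord_algebraMap_of_isUnit _ hu',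
      ord_algebraMap_of_irreducible hy ht']
    simp
  · rw [ord_eq_zero_of_coheight_neq_one hy, ord_eq_zero_of_coheight_neq_one (hco.symm ▸ hy)]

end FunctionFieldMap

section Hartogs

variable {X : Scheme.{u}} [IsIntegral X] [IsNormalScheme X]

theorem isIntegrallyClosed_of_isAffineOpen {W : X.Opens} (hW : IsAffineOpen W) [Nonempty W] :
    IsIntegrallyClosed Γ(X, W) := by
  have hmem (p : PrimeSpectrum Γ(X, W)) : hW.fromSpec p ∈ W := by
    rw [← SetLike.mem_coe, ← hW.range_fromSpec]
    exact ⟨p, rfl⟩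
  refine IsIntegrallyClosed.of_localization_maximal fun P _ hP => ?_
  let : Algebra Γ(X, W) (X.presheaf.stalk (hW.fromSpec ⟨P, hP.isPrime⟩)) :=
    X.presheaf.algebra_section_stalk ⟨_, hmem _⟩
  have : IsLocalization.AtPrime (X.presheaf.stalk (hW.fromSpec ⟨P, hP.isPrime⟩)) P :=
    hW.isLocalization_stalk' ⟨P, hP.isPrime⟩ (hmem _)
  have := IsNormalScheme.isIntegrallyClosed_stalk (hW.fromSpec ⟨P, hP.isPrime⟩)
  exact .of_equiv (IsLocalization.algEquiv P.primeCompl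
    (X.presheaf.stalk (hW.fromSpec ⟨P, hP.isPrime⟩)) (Localization.AtPrime P)).toRingEquiv

variable [IsLocallyNoetherian X]

theorem mem_range_germToFunctionField_of_isAffineOpen {W : X.Opens} (hW : IsAffineOpen W)
    [Nonempty W] (f : X.functionField)
    (h : ∀ x ∈ W, Order.coheight x = 1 → 0 ≤ ord f x) :
    f ∈ (X.germToFunctionField W).hom.range := by
  by_cases hf : f = 0
  · rw [hf]; exact zero_mem _
  have := isIntegrallyClosed_of_isAffineOpen hW
  have : IsNoetherianRing Γ(X, W) := IsLocallyNoetherian.component_noetherian ⟨W, hW⟩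
  have := functionField_isFractionRing_of_isAffineOpen X W hW
  refine mem_range_algebraMap_of_forall_height_eq_one (A := Γ(X, W)) f fun p hp hp1 => ?_
  have hmem : hW.fromSpec ⟨p, hp⟩ ∈ W := by
    rw [← SetLike.mem_coe, ← hW.range_fromSpec]
    exact ⟨_, rfl⟩
  set x := hW.fromSpec ⟨p, hp⟩ with hx
  let : Algebra Γ(X, W) (X.presheaf.stalk x) := X.presheaf.algebra_section_stalk ⟨x, hmem⟩
  have hloc : IsLocalization.AtPrime (X.presheaf.stalk x) p :=
    hW.isLocalization_stalk' ⟨p, hp⟩ hmem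
  have hx1 : Order.coheight x = 1 := by
    have h1 := ringKrullDim_stalk_eq_coheight x
    rw [IsLocalization.AtPrime.ringKrullDim_eq_height p, hp1] at h1
    exact_mod_cast h1.symm
  have := isDiscreteValuationRing_stalk X x hx1
  obtain ⟨s, hs⟩ := mem_range_algebraMap_of_zero_le_ord hx1 hf (h x hmem hx1)
  obtain ⟨⟨a, b⟩, hab⟩ := IsLocalization.surj p.primeCompl s
  have : IsScalarTower Γ(X, W) (X.presheaf.stalk x) X.functionField :=
    functionField_isScalarTower X W ⟨x, hmem⟩
  refine ⟨b, b.2, a, ?_⟩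
  rw [IsScalarTower.algebraMap_apply _ (X.presheaf.stalk x), ← hab, map_mul, hs, mul_comm,
    ← IsScalarTower.algebraMap_apply]

/-- Hartogs' lemma: on a normal locally Noetherian integral scheme, a rational function without poles in
codimension one on an open set is regular there. -/
theorem mem_range_germToFunctionField {W : X.Opens} [hWne : Nonempty W] (f : X.functionField)
    (h : ∀ x ∈ W, Order.coheight x = 1 → 0 ≤ ord f x) :
    f ∈ (X.germToFunctionField W).hom.range := by
  have hcov : ∀ x : W, ∃ V : X.Opens, IsAffineOpen V ∧ x.1 ∈ V ∧ V ≤ W := by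
    intro x
    obtain ⟨_, ⟨V, hV, rfl⟩, hxV, hVW⟩ :=
      X.isBasis_affineOpens.exists_subset_of_mem_open x.2 W.isOpen
    exact ⟨V, hV, hxV, hVW⟩
  choose V hV hxV hVW using hcov
  have (x : W) : Nonempty (V x) := ⟨⟨_, hxV x⟩⟩
  have hsec (x : W) := mem_range_germToFunctionField_of_isAffineOpen (hV x) f
    fun y hy => h y (hVW x hy)
  choose s hs using hsec
  -- The local sections agree on overlaps because they agree in the function field.
  have hcompat : TopCat.Presheaf.IsCompatible X.presheaf V s := by
    intro x y
    have : Nonempty (V x ⊓ V y : X.Opens) :=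
      (nonempty_preirreducible_inter (V x).isOpen (V y).isOpen ⟨_, hxV x⟩ ⟨_, hxV y⟩).to_subtype
    apply X.germToFunctionField_injective (V x ⊓ V y)
    have h1 := X.presheaf.germ_res_apply (homOfLE (inf_le_left : V x ⊓ V y ≤ V x))
      (genericPoint X) (((genericPoint_spec X).mem_open_set_iff (V x ⊓ V y).isOpen).mpr
        (by simpa using this)) (s x)
    have h2 := X.presheaf.germ_res_apply (homOfLE (inf_le_right : V x ⊓ V y ≤ V y))
      (genericPoint X) (((genericPoint_spec X).mem_open_set_iff (V x ⊓ V y).isOpen).mpr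
        (by simpa using this)) (s y)
    exact (h1.trans (hs x)).trans (h2.trans (hs y)).symm
  obtain ⟨t, ht, -⟩ := X.sheaf.existsUnique_gluing' V W (fun x => homOfLE (hVW x))
    (fun x hx => TopologicalSpace.Opens.mem_iSup.2 ⟨⟨x, hx⟩, hxV ⟨x, hx⟩⟩) s hcompat
  refine ⟨t, ?_⟩
  obtain ⟨x⟩ := hWne
  rw [← hs x, ← ht x]
  exact (X.presheaf.germ_res_apply (homOfLE (hVW x)) (genericPoint X) _ t).symm

end Hartogs

section PrimeDivisors

variable {X : Scheme.{u}} [IsIntegral X]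

/-- The points of codimension one outside a non-empty open set are generic points of irreducible
components of its complement. -/
theorem finite_coheight_eq_one_notMem [TopologicalSpace.NoetherianSpace X] (V : X.Opens)
    [hV : Nonempty V] : {x : X | Order.coheight x = 1 ∧ x ∉ V}.Finite := by
  obtain ⟨S, hS, hScl, hSirr, hSV⟩ :=
    TopologicalSpace.NoetherianSpace.exists_finite_set_isClosed_irreducible
      (isClosed_compl_iff.2 V.isOpen)
  have hgen : ∀ t : S, ∃ y : X, IsGenericPoint y t.1 := fun t =>
    QuasiSober.sober (hSirr t.1 t.2) (hScl t.1 t.2)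
  choose y hy using hgen
  have := hS.to_subtype
  refine (Set.finite_range y).subset ?_
  rintro x ⟨hx1, hxV⟩
  have hxS : x ∈ ⋃₀ S := hSV ▸ hxV
  obtain ⟨t, ht, hxt⟩ := hxS
  refine ⟨⟨t, ht⟩, ?_⟩
  have hspec : y ⟨t, ht⟩ ⤳ x := (hy ⟨t, ht⟩).specializes hxt
  have hyV : y ⟨t, ht⟩ ∉ V := by
    have h1 : y ⟨t, ht⟩ ∈ ⋃₀ S := ⟨t, ht, (hy ⟨t, ht⟩).mem⟩
    rw [← hSV] at h1
    exact h1
  by_contra hne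
  have hlt : x < y ⟨t, ht⟩ :=
    lt_of_le_not_ge hspec fun h => hne (hspec.antisymm h).eq
  have hlt' : y ⟨t, ht⟩ < genericPoint X := by
    refine lt_of_le_not_ge (genericPoint_specializes _) fun h => hyV ?_
    exact h.mem_open V.isOpen
      (((genericPoint_spec X).mem_open_set_iff V.isOpen).mpr (by simpa using hV))
  have h1 := Order.coheight_add_one_le hlt
  have h2 := Order.coheight_add_one_le hlt'
  rw [hx1] at h1
  have h3 : (1 : ℕ∞) ≤ Order.coheight (y ⟨t, ht⟩) := le_trans (by simp) h2
  exact absurd ((add_le_add_left h3 1).trans h1) (by decide)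

variable [IsLocallyNoetherian X] [IsNormalScheme X]

/-- On an affine open set with factorial coordinate ring, prime divisors are principal. -/
theorem exists_ord_eq_single {V : X.Opens} (hV : IsAffineOpen V) [Nonempty V]
    [UniqueFactorizationMonoid Γ(X, V)] {x : X} (hx : x ∈ V) (hx1 : Order.coheight x = 1) :
    ∃ f : X.functionField, f ≠ 0 ∧ ord f x = 1 ∧
      ∀ y ∈ V, Order.coheight y = 1 → y ≠ x → ord f y = 0 := by
  have hheight (y : X) (hy : y ∈ V) (hy1 : Order.coheight y = 1) :
      (hV.primeIdealOf ⟨y, hy⟩).asIdeal.height = 1 := by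
    let : Algebra Γ(X, V) (X.presheaf.stalk y) := X.presheaf.algebra_section_stalk ⟨y, hy⟩
    have hloc : IsLocalization.AtPrime (X.presheaf.stalk y)
      (hV.primeIdealOf ⟨y, hy⟩).asIdeal := hV.isLocalization_stalk ⟨y, hy⟩
    have h1 := ringKrullDim_stalk_eq_coheight y
    rw [IsLocalization.AtPrime.ringKrullDim_eq_height (hV.primeIdealOf ⟨y, hy⟩).asIdeal,
      hy1] at h1
    exact_mod_cast h1
  obtain ⟨g, hgmem, hg⟩ := (hV.primeIdealOf ⟨x, hx⟩).isPrime.exists_mem_prime_of_ne_bot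
    (Ideal.ne_bot_of_height_eq_one (hheight x hx hx1))
  have hgspan := Ideal.eq_span_singleton_of_height_eq_one (hheight x hx hx1) hgmem hg
  refine ⟨X.germToFunctionField V g, ?_, ?_, ?_⟩
  · exact (map_ne_zero_iff _ (X.germToFunctionField_injective V)).2 hg.ne_zero
  · have := isDiscreteValuationRing_stalk X x hx1
    let : Algebra Γ(X, V) (X.presheaf.stalk x) := X.presheaf.algebra_section_stalk ⟨x, hx⟩
    have hloc : IsLocalization.AtPrime (X.presheaf.stalk x)
      (hV.primeIdealOf ⟨x, hx⟩).asIdeal := hV.isLocalization_stalk ⟨x, hx⟩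
    rw [← algebraMap_germ_eq_germToFunctionField X hx]
    refine ord_algebraMap_of_irreducible hx1 ?_
    have hmax := IsLocalization.AtPrime.map_eq_maximalIdeal
      (hV.primeIdealOf ⟨x, hx⟩).asIdeal (X.presheaf.stalk x)
    rw [hgspan, Ideal.map_span, Set.image_singleton] at hmax
    refine IsDiscreteValuationRing.irreducible_of_span_eq_maximalIdeal _ ?_ hmax.symm
    exact (map_ne_zero_iff _ (germ_injective_of_isIntegral X x hx)).2 hg.ne_zero
  · intro y hy hy1 hyx
    rw [← algebraMap_germ_eq_germToFunctionField X hy]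
    refine ord_algebraMap_of_isUnit y ?_
    let : Algebra Γ(X, V) (X.presheaf.stalk y) := X.presheaf.algebra_section_stalk ⟨y, hy⟩
    have hloc : IsLocalization.AtPrime (X.presheaf.stalk y)
      (hV.primeIdealOf ⟨y, hy⟩).asIdeal := hV.isLocalization_stalk ⟨y, hy⟩
    refine (IsLocalization.AtPrime.isUnit_to_map_iff (X.presheaf.stalk y)
      (hV.primeIdealOf ⟨y, hy⟩).asIdeal g).2 fun hgy => hyx ?_
    have hgspan' := Ideal.eq_span_singleton_of_height_eq_one (hheight y hy hy1) hgy hg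
    have heq : hV.primeIdealOf ⟨y, hy⟩ = hV.primeIdealOf ⟨x, hx⟩ :=
      PrimeSpectrum.ext (hgspan'.trans hgspan.symm)
    have h1 := hV.fromSpec_primeIdealOf ⟨y, hy⟩
    rw [heq, hV.fromSpec_primeIdealOf] at h1
    exact h1.symm

end PrimeDivisors

end AlgebraicGeometry.Scheme

/-! ### The action of the rational points of the torus -/

namespace AddMonoidAlgebra

variable {k M : Type*} [CommRing k] [AddCommGroup M]

/-- The endomorphism `χ^m ↦ c(m) χ^m` of the group algebra, by which the point `c` of the torus acts
on functions. -/
noncomputable def scale (c : Multiplicative M →* k) :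
    AddMonoidAlgebra k M →ₐ[k] AddMonoidAlgebra k M :=
  AddMonoidAlgebra.lift k (AddMonoidAlgebra k M) M
    { toFun := fun m => AddMonoidAlgebra.single m.toAdd (c m)
      map_one' := by simp [AddMonoidAlgebra.one_def]
      map_mul' := fun m n => by simp [AddMonoidAlgebra.single_mul_single] }

theorem scale_single (c : Multiplicative M →* k) (m : M) (r : k) :
    scale c (AddMonoidAlgebra.single m r) = AddMonoidAlgebra.single m (c (.ofAdd m) * r) := by
  simp [scale, mul_comm]

theorem convMul_single {A : Type*} [CommRing A] [Algebra k A]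
    (f g : WithConv (AddMonoidAlgebra k M →ₐ[k] A)) (m : M) :
    (f * g).ofConv (single m 1) = f.ofConv (single m 1) * g.ofConv (single m 1) := by
  have := AlgHom.convMul_apply f g (single m 1)
  rw [comul_single] at this
  exact this.trans (by simp)

end AddMonoidAlgebra

namespace splitTorus

variable {k M : Type u} [Field k] [AddCommGroup M]
open MonoidalCategory CartesianMonoidalCategory MonObj AddMonoidAlgebra

/-- The constant morphism from `Y` to the torus with value the `k`-point `χ^m ↦ c(m)`. A `k`-point
is encoded as a monoid homomorphism from the character lattice to `k`. -/
noncomputable def point (c : Multiplicative M →* k) (Y : Over (Spec (.of k))) :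
    Y ⟶ splitTorus k M :=
  (Over.homMk Y.hom (by
    have : CommRingCat.ofHom (algebraMap k k) = 𝟙 (CommRingCat.of k) := rfl
    simp only [specOverSpec_over, this, Spec.map_id, OverClass.asOver_hom]
    exact Category.comp_id _) :
    Y ⟶ (Spec (.of k)).asOver (Spec (.of k))) ≫
  Spec.mapMulEquiv (R := k) (S := AddMonoidAlgebra k M) (T := k)
    (WithConv.toConv (AddMonoidAlgebra.lift k k M c))

theorem comp_point (c : Multiplicative M →* k) {Y Z : Over (Spec (.of k))} (g : Z ⟶ Y) :
    g ≫ point c Y = point (M := M) c Z := by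
  rw [point, point, ← Category.assoc]
  congr 1
  ext
  exact Over.w g

theorem point_one (Y : Over (Spec (.of k))) : point (1 : Multiplicative M →* k) Y = 1 := by
  have : WithConv.toConv (AddMonoidAlgebra.lift k k M 1) = 1 := by
    apply WithConv.ofConv_injective
    ext m
    simp
  rw [point, this, map_one, MonObj.comp_one]

theorem point_mul (c d : Multiplicative M →* k) (Y : Over (Spec (.of k))) :
    point (c * d) Y = point c Y * point d Y := by
  have : WithConv.toConv (AddMonoidAlgebra.lift k k M (c * d)) =
      WithConv.toConv (AddMonoidAlgebra.lift k k M c) *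
        WithConv.toConv (AddMonoidAlgebra.lift k k M d) := by
    apply WithConv.ofConv_injective
    ext m
    simp
  rw [point, point, point, ← MonObj.comp_mul, ← map_mul, this]

/-- Translation by the point `c` of the torus. -/
theorem point_mul_id (c : Multiplicative M →* k)  :
    (point c (splitTorus k M) * 𝟙 _).left = Spec.map (CommRingCat.ofHom (scale c).toRingHom) := by
  have h1 : point c (splitTorus k M) = Spec.mapMulEquiv
      (WithConv.toConv ((Algebra.ofId k (AddMonoidAlgebra k M)).comp
        (AddMonoidAlgebra.lift k k M c))) := by
    ext
    simp only [point, Over.comp_left]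
    exact (Spec.map_comp _ _).symm
  have h2 : 𝟙 (splitTorus k M) = Spec.mapMulEquiv
      (WithConv.toConv (AlgHom.id k (AddMonoidAlgebra k M))) := by
    ext
    exact (Spec.map_id _).symm
  rw [h1, h2, ← map_mul]
  have h3 : WithConv.toConv ((Algebra.ofId k (AddMonoidAlgebra k M)).comp
        (AddMonoidAlgebra.lift k k M c)) *
      WithConv.toConv (AlgHom.id k (AddMonoidAlgebra k M)) = WithConv.toConv (scale c) := by
    apply WithConv.ofConv_injective
    refine AddMonoidAlgebra.algHom_ext (fun m => ?_) (Subsingleton.elim _ _)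
    rw [convMul_single]
    simp [scale_single, Algebra.ofId_apply, single_mul_single]
  rw [h3]
  rfl

end splitTorus

namespace ToricVariety

variable {k M : Type u} [Field k] [AddCommGroup M] [Module.Free ℤ M] [Module.Finite ℤ M]
  (U : ToricVariety k M)

open splitTorus MonObj AddMonoidAlgebra

/-- The endomorphism of `U` by which the `k`-point `c` of the torus acts. -/
noncomputable def translate (c : Multiplicative M →* k) : U.X ⟶ U.X :=
  letI := U.action
  point c U.X • 𝟙 U.X

theorem translate_one : U.translate 1 = 𝟙 U.X := by
  let := U.action
  rw [translate, point_one, one_smul]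

theorem translate_mul (c d : Multiplicative M →* k) :
    U.translate (c * d) = U.translate d ≫ U.translate c := by
  let := U.action
  simp only [translate]
  rw [ModObj.comp_smul, comp_point, Category.comp_id, point_mul, mul_smul]

instance isIso_translate (c : Multiplicative M →* kˣ) :
    IsIso (U.translate ((Units.coeHom k).comp c)).left := by
  have : IsIso (U.translate ((Units.coeHom k).comp c)) := by
    refine ⟨U.translate ((Units.coeHom k).comp c⁻¹), ?_, ?_⟩ <;>
    · rw [← translate_mul, ← translate_one]
      congr 1
      ext m
      simp
  exact inferInstanceAs (IsIso ((Over.forget _).map (U.translate ((Units.coeHom k).comp c))))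

/-- Equivariance of the torus embedding, for `k`-points of the torus. -/
theorem torusEmb_translate (c : Multiplicative M →* k) :
    U.torusEmb.left ≫ (U.translate c).left =
      Spec.map (CommRingCat.ofHom (scale c).toRingHom) ≫ U.torusEmb.left := by
  let := U.action
  let := ModObj.regular (splitTorus k M)
  have := U.equivariant
  rw [← point_mul_id]
  refine congrArg (fun f : splitTorus k M ⟶ U.X => f.left) (?_ : U.torusEmb ≫ U.translate c =
    (point c (splitTorus k M) * 𝟙 (splitTorus k M)) ≫ U.torusEmb)
  rw [translate, ModObj.comp_smul, comp_point, Category.comp_id]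
  have h := IsModHom.map_smul U.torusEmb (point c (splitTorus k M)) (𝟙 _)
  rw [Category.id_comp] at h
  exact h.symm

end ToricVariety

/-! ### Rational functions on a toric variety -/

namespace ToricVariety

variable {k M : Type u} [Field k] [AddCommGroup M] [Module.Free ℤ M] [Module.Finite ℤ M]
  (U : ToricVariety k M)

open splitTorus AddMonoidAlgebra Scheme

/-- The embedding of the torus as a morphism of schemes. -/
noncomputable abbrev embedding : Spec (.of (AddMonoidAlgebra k M)) ⟶ U.scheme :=
  U.torusEmb.left

instance : IsOpenImmersion U.embedding := U.isOpenImmersion_torusEmb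

/-- The dense open torus in a toric variety. -/
noncomputable abbrev torus : U.scheme.Opens := U.embedding ''ᵁ ⊤

instance : IsIntegral (Spec (.of (AddMonoidAlgebra k M))) :=
  have : IsDomain (CommRingCat.of (AddMonoidAlgebra k M)) :=
    inferInstanceAs (IsDomain (AddMonoidAlgebra k M))
  inferInstance

instance : Nonempty U.torus :=
  ⟨⟨U.embedding (genericPoint _), ⟨_, trivial, rfl⟩⟩⟩

theorem isAffineOpen_torus : IsAffineOpen U.torus := by
  rw [torus, Scheme.Hom.image_top_eq_opensRange]
  exact isAffineOpen_opensRange _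

theorem mem_torus_iff (x : U.scheme) : x ∈ U.torus ↔ ∃ y, U.embedding y = x := by
  rw [torus, Scheme.Hom.image_top_eq_opensRange]
  exact Iff.rfl

/-- Regular functions on the torus are the elements of the group algebra. -/
noncomputable def torusSectionsEquiv : AddMonoidAlgebra k M ≃+* Γ(U.scheme, U.torus) :=
  ((Scheme.ΓSpecIso (.of (AddMonoidAlgebra k M))).symm ≪≫
    (U.embedding.appIso ⊤).symm).commRingCatIsoToRingEquiv

instance : UniqueFactorizationMonoid Γ(U.scheme, U.torus) :=
  U.torusSectionsEquiv.toMulEquiv.uniqueFactorizationMonoid inferInstance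

/-- An element of the group algebra as a rational function on the toric variety. -/
noncomputable def rationalFunction : AddMonoidAlgebra k M →+* U.scheme.functionField :=
  (U.scheme.germToFunctionField U.torus).hom.comp U.torusSectionsEquiv.toRingHom

theorem rationalFunction_injective : Function.Injective U.rationalFunction :=
  (U.scheme.germToFunctionField_injective U.torus).comp U.torusSectionsEquiv.injective

theorem exists_rationalFunction_eq (f : U.scheme.functionField)
    (h : ∀ x ∈ U.torus, Order.coheight x = 1 → 0 ≤ ord f x) :
    ∃ a, U.rationalFunction a = f := by
  obtain ⟨s, rfl⟩ := mem_range_germToFunctionField f h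
  exact ⟨U.torusSectionsEquiv.symm s, by simp [rationalFunction]⟩

theorem zero_le_ord_rationalFunction (a : AddMonoidAlgebra k M) {x : U.scheme}
    (hx : x ∈ U.torus) (hx1 : Order.coheight x = 1) : 0 ≤ ord (U.rationalFunction a) x := by
  have := isDiscreteValuationRing_stalk U.scheme x hx1
  have h := zero_le_ord_algebraMap hx1
    (U.scheme.presheaf.germ U.torus x hx (U.torusSectionsEquiv a))
  rwa [algebraMap_germ_eq_germToFunctionField] at h

theorem embedding_genericPoint : U.embedding (genericPoint _) = genericPoint U.scheme :=
  genericPoint_eq_of_isOpenImmersion _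

theorem functionFieldMap_embedding_rationalFunction (a : AddMonoidAlgebra k M) :
    U.embedding.functionFieldMap U.embedding_genericPoint (U.rationalFunction a) =
      germToFunctionField _ ⊤ ((Scheme.ΓSpecIso (.of (AddMonoidAlgebra k M))).inv a) := by
  have : Nonempty (U.embedding ⁻¹ᵁ U.torus) := by
    rw [torus, Scheme.Hom.preimage_image_eq]; infer_instance
  have h := Scheme.Hom.functionFieldMap_germ U.embedding U.embedding_genericPoint U.torus
    (U.torusSectionsEquiv a)
  refine h.trans ?_
  have h2 : U.embedding.app U.torus (U.torusSectionsEquiv a) =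
      (Spec (.of (AddMonoidAlgebra k M))).presheaf.map
        (eqToHom (U.embedding.preimage_image_eq ⊤)).op
        ((Scheme.ΓSpecIso (.of (AddMonoidAlgebra k M))).inv a) :=
    congr($(U.embedding.appIso_inv_app ⊤) ((Scheme.ΓSpecIso (.of (AddMonoidAlgebra k M))).inv a))
  rw [h2]
  exact TopCat.Presheaf.germ_res_apply _ _ _ _ _

theorem translate_genericPoint (c : Multiplicative M →* kˣ) :
    (U.translate ((Units.coeHom k).comp c)).left (genericPoint U.scheme) =
      genericPoint U.scheme :=
  genericPoint_eq_of_isOpenImmersion _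

theorem functionFieldMap_translate_rationalFunction (c : Multiplicative M →* kˣ)
    (a : AddMonoidAlgebra k M) :
    (U.translate ((Units.coeHom k).comp c)).left.functionFieldMap (U.translate_genericPoint c)
      (U.rationalFunction a) = U.rationalFunction (scale ((Units.coeHom k).comp c) a) := by
  set c' := (Units.coeHom k).comp c
  let s := Spec.map (CommRingCat.ofHom (scale c').toRingHom)
  have heq : U.embedding ≫ (U.translate c').left = s ≫ U.embedding := U.torusEmb_translate c'
  apply (U.embedding.functionFieldMap U.embedding_genericPoint).injective
  have hgen : (U.embedding ≫ (U.translate c').left) (genericPoint _) = genericPoint U.scheme := by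
    rw [Scheme.Hom.comp_apply, U.embedding_genericPoint, U.translate_genericPoint c]
  have hs : s (genericPoint _) = genericPoint _ := by
    apply U.embedding.injective
    rw [← Scheme.Hom.comp_apply, ← heq, hgen, U.embedding_genericPoint]
  rw [← Scheme.Hom.functionFieldMap_comp _ _ _ _ hgen]
  have h1 : ∀ (g h : Spec (.of (AddMonoidAlgebra k M)) ⟶ U.scheme) (hg : g (genericPoint _) = _)
    (hh : h (genericPoint _) = _) (_ : g = h) (f : U.scheme.functionField),
      g.functionFieldMap hg f = h.functionFieldMap hh f := by
    rintro g _ hg hh rfl f; rfl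
  rw [h1 _ _ hgen (heq ▸ hgen) heq, Scheme.Hom.functionFieldMap_comp _ _ hs
    U.embedding_genericPoint, functionFieldMap_embedding_rationalFunction,
    functionFieldMap_embedding_rationalFunction]
  have : Nonempty (s ⁻¹ᵁ ⊤) := inferInstanceAs (Nonempty (⊤ : (Spec _).Opens))
  refine (Scheme.Hom.functionFieldMap_germ s hs ⊤ _).trans ?_
  have h2 := congr($(Scheme.ΓSpecIso_inv_naturality
    (CommRingCat.ofHom (scale c').toRingHom)) a)
  exact congrArg _ h2.symm

end ToricVariety

/-! ### Sections of divisors on a toric variety -/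

namespace ToricVariety

variable {k M : Type u} [Field k] [AddCommGroup M] [Module.Free ℤ M] [Module.Finite ℤ M]
  (U : ToricVariety k M)

open splitTorus AddMonoidAlgebra Scheme

/-- A toric variety has finitely many boundary divisors. -/
theorem finite_boundary : {x : U.scheme | Order.coheight x = 1 ∧ x ∉ U.torus}.Finite := by
  have := U.quasiCompact
  have : CompactSpace U.scheme := QuasiCompact.compactSpace_of_compactSpace U.X.hom
  have : IsNoetherian U.scheme := { }
  exact finite_coheight_eq_one_notMem U.torus

/-- Constants as global regular functions. -/
noncomputable def constant : k →+* Γ(U.scheme, ⊤) :=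
  ((Scheme.ΓSpecIso (.of k)).inv ≫ U.X.hom.appTop).hom

theorem germ_constant (r : k) :
    U.scheme.germToFunctionField ⊤ (U.constant r) = U.rationalFunction (single 0 r) := by
  apply (U.embedding.functionFieldMap U.embedding_genericPoint).injective
  rw [functionFieldMap_embedding_rationalFunction]
  have : Nonempty (U.embedding ⁻¹ᵁ ⊤) := inferInstanceAs (Nonempty (⊤ : (Spec _).Opens))
  refine (Scheme.Hom.functionFieldMap_germ _ U.embedding_genericPoint ⊤ _).trans ?_
  have h1 : U.embedding ≫ U.X.hom = Spec.map (CommRingCat.ofHom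
      (algebraMap k (AddMonoidAlgebra k M))) := Over.w U.torusEmb
  have h2 := congr($(Scheme.ΓSpecIso_inv_naturality
    (CommRingCat.ofHom (algebraMap k (AddMonoidAlgebra k M)))) r)
  rw [← h1] at h2
  exact congrArg (germToFunctionField _ ⊤) h2.symm

theorem ord_rationalFunction_single (m : M) {r : k} (hr : r ≠ 0) (x : U.scheme) :
    ord (U.rationalFunction (single m r)) x = ord (U.rationalFunction (single m 1)) x := by
  have hne (m : M) {r : k} (hr : r ≠ 0) : U.rationalFunction (single m r) ≠ 0 :=
    (map_ne_zero_iff _ U.rationalFunction_injective).2 (by simpa using hr)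
  have h : single m r = (single 0 r * single m 1 : AddMonoidAlgebra k M) := by
    simp [single_mul_single]
  rw [h, map_mul, ord_mul (hne _ hr) (hne _ one_ne_zero), ← germ_constant,
    ord_of_isUnit ((IsUnit.mk0 r hr).map U.constant) trivial, zero_add]

/-- The order of vanishing of the character `χ^m` at the point `x`. At the generic point of a boundary
divisor it is the pairing of `m` with the ray of that divisor. -/
noncomputable def characterOrd (m : M) (x : U.scheme) : ℤ :=
  ord (U.rationalFunction (single m 1)) x

theorem characterOrd_add (m n : M) (x : U.scheme) :
    U.characterOrd (m + n) x = U.characterOrd m x + U.characterOrd n x := by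
  have hne (m : M) : U.rationalFunction (single m 1) ≠ 0 :=
    (map_ne_zero_iff _ U.rationalFunction_injective).2 (by simp)
  rw [characterOrd, characterOrd, characterOrd, ← ord_mul (hne _) (hne _), ← map_mul,
    single_mul_single, one_mul]

theorem characterOrd_of_mem_torus (m : M) {x : U.scheme} (hx : x ∈ U.torus) :
    U.characterOrd m x = 0 := by
  refine ord_of_isUnit (U := U.torus) (IsUnit.map U.torusSectionsEquiv ?_) hx
  exact ⟨⟨single m 1, single (-m) 1, by simp [single_mul_single, AddMonoidAlgebra.one_def],
    by simp [single_mul_single, AddMonoidAlgebra.one_def]⟩, rfl⟩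

theorem translate_mem_torus_iff (c : Multiplicative M →* kˣ) (x : U.scheme) :
    (U.translate ((Units.coeHom k).comp c)).left x ∈ U.torus ↔ x ∈ U.torus := by
  have key : ∀ (d : Multiplicative M →* k) (y : U.scheme), y ∈ U.torus →
      (U.translate d).left y ∈ U.torus := by
    intro d y hy
    obtain ⟨z, rfl⟩ := (U.mem_torus_iff y).1 hy
    refine (U.mem_torus_iff _).2
      ⟨Spec.map (CommRingCat.ofHom (scale d).toRingHom) z, ?_⟩
    rw [← Scheme.Hom.comp_apply, ← Scheme.Hom.comp_apply]
    exact congr($(U.torusEmb_translate d) z).symm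
  refine ⟨fun h => ?_, key _ x⟩
  have h1 := key ((Units.coeHom k).comp c⁻¹) _ h
  have h2 : U.translate ((Units.coeHom k).comp c) ≫ U.translate ((Units.coeHom k).comp c⁻¹) =
      𝟙 U.X := by
    rw [← translate_mul, ← translate_one]
    congr 1
    ext m
    simp
  have h3 := congr(Over.Hom.left $h2 x)
  rw [Over.comp_left, Scheme.Hom.comp_apply] at h3
  rw [h3] at h1
  exact h1

theorem coheight_translate (c : Multiplicative M →* kˣ) (x : U.scheme) :
    Order.coheight ((U.translate ((Units.coeHom k).comp c)).left x) = Order.coheight x :=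
  coheight_eq_of_isOpenImmersion _

/-- Translations permute the finitely many boundary divisors, so that a power fixes all of them. -/
theorem exists_iterate_translate_eq (c : Multiplicative M →* kˣ) :
    ∃ N, 0 < N ∧ ∀ x : U.scheme, Order.coheight x = 1 → x ∉ U.torus →
      (⇑(U.translate ((Units.coeHom k).comp c)).left)^[N] x = x := by
  classical
  let E : Type u := {x : U.scheme | Order.coheight x = 1 ∧ x ∉ U.torus}
  have : Finite E := U.finite_boundary
  let σ : E → E := fun x => ⟨(U.translate ((Units.coeHom k).comp c)).left x.1,
    (U.coheight_translate c x.1).trans x.2.1,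
    fun h => x.2.2 ((U.translate_mem_torus_iff c x.1).1 h)⟩
  have hσ : Function.Injective σ := fun x y h => Subtype.ext
    ((U.translate ((Units.coeHom k).comp c)).left.injective (congrArg Subtype.val h))
  let e : Equiv.Perm E := Equiv.ofBijective σ (Finite.injective_iff_bijective.1 hσ)
  refine ⟨orderOf e, orderOf_pos e, fun x hx1 hx => ?_⟩
  have h1 : ∀ (n : ℕ) (y : E),
      ((e ^ n) y).1 = (⇑(U.translate ((Units.coeHom k).comp c)).left)^[n] y.1 := by
    intro n
    induction n with
    | zero => intro y; rfl
    | succ n ih =>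
      intro y
      rw [pow_succ, Equiv.Perm.mul_apply, ih, Function.iterate_succ_apply]
      rfl
  have h2 := h1 (orderOf e) ⟨x, hx1, hx⟩
  rw [pow_orderOf_eq_one] at h2
  exact h2.symm

theorem ord_iterate_functionFieldMap (c : Multiplicative M →* kˣ) (f : U.scheme.functionField)
    (n : ℕ) (x : U.scheme) :
    ord (((U.translate ((Units.coeHom k).comp c)).left.functionFieldMap
      (U.translate_genericPoint c))^[n] f) x =
      ord f ((⇑(U.translate ((Units.coeHom k).comp c)).left)^[n] x) := by
  induction n generalizing x with
  | zero => rfl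
  | succ n ih =>
    rw [Function.iterate_succ_apply', Scheme.Hom.ord_functionFieldMap, ih,
      Function.iterate_succ_apply]

theorem iterate_translate_mem_torus (c : Multiplicative M →* kˣ) (n : ℕ) (x : U.scheme)
    (hx : x ∈ U.torus) : (⇑(U.translate ((Units.coeHom k).comp c)).left)^[n] x ∈ U.torus := by
  induction n with
  | zero => exact hx
  | succ n ih => rw [Function.iterate_succ_apply']; exact (U.translate_mem_torus_iff c _).2 ih

theorem coheight_iterate_translate (c : Multiplicative M →* kˣ) (n : ℕ) (x : U.scheme) :
    Order.coheight ((⇑(U.translate ((Units.coeHom k).comp c)).left)^[n] x) =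
      Order.coheight x := by
  induction n with
  | zero => rfl
  | succ n ih => rw [Function.iterate_succ_apply']; exact (U.coheight_translate c _).trans ih

theorem iterate_functionFieldMap_rationalFunction (c : Multiplicative M →* kˣ) (n : ℕ)
    (a : AddMonoidAlgebra k M) :
    ((U.translate ((Units.coeHom k).comp c)).left.functionFieldMap
      (U.translate_genericPoint c))^[n] (U.rationalFunction a) =
      U.rationalFunction (((scale ((Units.coeHom k).comp c)).toLinearMap ^ n) a) := by
  induction n with
  | zero => rfl
  | succ n ih =>
    rw [Function.iterate_succ_apply', ih, functionFieldMap_translate_rationalFunction, pow_succ']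
    rfl

variable {U}

theorem mem_H0_iff {D : WeilDivisor U.scheme} {f : U.scheme.functionField} :
    f ∈ D.H0 ↔ (f ≠ 0 → ∀ P : PrimeDivisor U.scheme, 0 ≤ ord f P.1 + D P) :=
  ⟨fun h hf P => h hf P trivial, fun h hf P _ => h hf P⟩

/-- The sections of `𝒪(D)` that are regular on the torus, as a subspace of the group algebra. -/
noncomputable def laurentH0 (D : WeilDivisor U.scheme) :
    Submodule k (AddMonoidAlgebra k M) where
  carrier := {a | U.rationalFunction a ∈ D.H0}
  zero_mem' := by simp
  add_mem' := fun ha hb => by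
    simp only [Set.mem_ofPred_eq, map_add] at ha hb ⊢
    exact add_mem ha hb
  smul_mem' := fun r a ha => by
    simp only [Set.mem_ofPred_eq] at ha ⊢
    have h : r • a = single 0 r * a := by
      rw [Algebra.smul_def]; rfl
    rw [h, map_mul, ← germ_constant]
    exact D.H0.smul_mem (U.constant r) ha

/-- If `D` is supported on the boundary, then `H⁰(U, 𝒪(D))` is graded by the characters. Indeed a power
of the translation by `c` fixes the boundary divisors and thus preserves this space, and the
characters are eigenvectors of it with distinct eigenvalues by the hypothesis on `c`. -/
theorem single_mem_laurentH0 (c : Multiplicative M →* kˣ)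
    (hc : ∀ N, 0 < N → Function.Injective fun m => c m ^ N) {D : WeilDivisor U.scheme}
    (hD : ∀ P : PrimeDivisor U.scheme, P.1 ∈ U.torus → D P = 0) {a : AddMonoidAlgebra k M}
    (ha : a ∈ laurentH0 D) {m : M} (hm : m ∈ a.coeff.support) :
    single m (a.coeff m) ∈ laurentH0 D := by
  obtain ⟨N, hN, hfix⟩ := U.exists_iterate_translate_eq c
  refine Submodule.mem_of_sum_mem_of_eigenvectors (laurentH0 D)
    ((scale ((Units.coeHom k).comp c)).toLinearMap ^ N) ?_ (fun m => ((c (.ofAdd m) ^ N : kˣ) : k))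
    (Units.val_injective.comp ((hc N hN).comp Multiplicative.ofAdd.injective))
    a.coeff.support (fun m => single m (a.coeff m)) ?_ ?_ m hm
  · intro b hb
    by_cases hb0 : U.rationalFunction b = 0
    · rw [map_eq_zero_iff _ U.rationalFunction_injective] at hb0
      rw [hb0, map_zero]
      exact zero_mem _
    refine mem_H0_iff.2 fun _ P => ?_
    rw [← iterate_functionFieldMap_rationalFunction, ord_iterate_functionFieldMap]
    by_cases hP : P.1 ∈ U.torus
    · rw [hD P hP, add_zero]
      exact U.zero_le_ord_rationalFunction b (U.iterate_translate_mem_torus c N _ hP)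
        ((U.coheight_iterate_translate c N _).trans P.2)
    · rw [hfix P.1 P.2 hP]
      exact mem_H0_iff.1 hb hb0 P
  · intro m
    have : ∀ n : ℕ, ∀ r : k, ((scale ((Units.coeHom k).comp c)).toLinearMap ^ n) (single m r) =
        single m (((c (.ofAdd m) ^ n : kˣ) : k) * r) := by
      intro n
      induction n with
      | zero => simp
      | succ n ih =>
        intro r
        rw [pow_succ', Module.End.mul_apply, ih, AlgHom.toLinearMap_apply, scale_single]
        simp only [MonoidHom.comp_apply, Units.coeHom_apply, Units.val_pow_eq_pow_val]
        ring_nf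
    rw [this, smul_single, smul_eq_mul]
  · have := a.sum_coeff_single
    rw [Finsupp.sum] at this
    rwa [this]

theorem fg_H0_of_forall_mem_torus (c : Multiplicative M →* kˣ)
    (hc : ∀ N, 0 < N → Function.Injective fun m => c m ^ N) {D : WeilDivisor U.scheme}
    (hD : ∀ P : PrimeDivisor U.scheme, P.1 ∈ U.torus → D P = 0) : D.H0.FG := by
  classical
  let E : Type u := {x : U.scheme | Order.coheight x = 1 ∧ x ∉ U.torus}
  have : Finite E := U.finite_boundary
  -- The characters that are sections; as conditions on `m`, these are inequalities
  -- `-D x ≤ characterOrd m x` at the boundary divisors.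
  let P : Set M := {m | single m 1 ∈ laurentH0 D}
  have hne (m : M) {r : k} (hr : r ≠ 0) : U.rationalFunction (single m r) ≠ 0 :=
    (map_ne_zero_iff _ U.rationalFunction_injective).2 (by simpa using hr)
  obtain ⟨F, hFP, hF⟩ := exists_finset_forall_exists_le
    (fun (m : M) (x : E) => U.characterOrd m x.1) P (fun x => -D ⟨x.1, x.2.1⟩) (by
      intro m hm x
      have := mem_H0_iff.1 hm (hne m one_ne_zero) ⟨x.1, x.2.1⟩
      change -D ⟨x.1, x.2.1⟩ ≤ ord _ x.1
      change 0 ≤ ord _ x.1 + D ⟨x.1, x.2.1⟩ at this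
      omega)
  refine ⟨F.image fun m => U.rationalFunction (single m 1), le_antisymm ?_ ?_⟩
  · rw [Submodule.span_le]
    intro f hf
    obtain ⟨m, hm, rfl⟩ := Finset.mem_image.1 (Finset.mem_coe.1 hf)
    exact hFP hm
  · intro f hf
    obtain ⟨a, rfl⟩ := U.exists_rationalFunction_eq f (by
      intro x hx hx1
      by_cases hf0 : f = 0
      · simp [hf0]
      · have := mem_H0_iff.1 hf hf0 ⟨x, hx1⟩
        rwa [hD ⟨x, hx1⟩ hx, add_zero] at this)
    rw [← a.sum_coeff_single, Finsupp.sum, map_sum]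
    refine Submodule.sum_mem _ fun m hm => ?_
    have hr : a.coeff m ≠ 0 := Finsupp.mem_support_iff.1 hm
    have hmP : m ∈ P := by
      have h := (laurentH0 D).smul_mem (a.coeff m)⁻¹
        (single_mem_laurentH0 c hc hD (a := a) hf hm)
      rwa [smul_single, smul_eq_mul, inv_mul_cancel₀ hr] at h
    obtain ⟨m₀, hm₀, hle⟩ := hF m hmP
    -- `χ^(m - m₀)` has no poles, so that it is a global regular function.
    obtain ⟨s, hs⟩ := mem_range_germToFunctionField (W := ⊤)
        (U.rationalFunction (single (m - m₀) (a.coeff m))) (by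
      intro x _ hx1
      rw [ord_rationalFunction_single _ _ hr]
      change 0 ≤ U.characterOrd _ x
      by_cases hx : x ∈ U.torus
      · rw [characterOrd_of_mem_torus _ _ hx]
      · have h1 := U.characterOrd_add (m - m₀) m₀ x
        rw [sub_add_cancel] at h1
        have h2 : U.characterOrd m₀ x ≤ U.characterOrd m x := hle ⟨x, hx1, hx⟩
        omega)
    have hmul : U.rationalFunction (single m (a.coeff m)) =
        s • U.rationalFunction (single m₀ 1) := by
      rw [Algebra.smul_def]
      change _ = (U.scheme.germToFunctionField ⊤).hom s * _
      rw [hs, ← map_mul, single_mul_single, sub_add_cancel, mul_one]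
    rw [hmul]
    exact Submodule.smul_mem _ _ (Submodule.subset_span (by
      simpa using ⟨m₀, hm₀, rfl⟩))

/-- Every divisor is linearly equivalent to one supported on the boundary, as the group algebra is
factorial. -/
theorem exists_ord_eq (D : WeilDivisor U.scheme) :
    ∃ h : U.scheme.functionField, h ≠ 0 ∧
      ∀ P : PrimeDivisor U.scheme, P.1 ∈ U.torus → ord h P.1 = D P := by
  classical
  have hex : ∀ P : PrimeDivisor U.scheme, ∃ f : U.scheme.functionField, f ≠ 0 ∧
      ∀ Q : PrimeDivisor U.scheme, Q.1 ∈ U.torus → P.1 ∈ U.torus →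
        ord f Q.1 = if Q = P then 1 else 0 := by
    intro P
    by_cases hP : P.1 ∈ U.torus
    · obtain ⟨f, hf, hfP, hfQ⟩ := exists_ord_eq_single U.isAffineOpen_torus hP P.2
      refine ⟨f, hf, fun Q hQ _ => ?_⟩
      split_ifs with h
      · rw [h, hfP]
      · exact hfQ Q.1 hQ Q.2 fun h' => h (Subtype.ext h')
    · exact ⟨1, one_ne_zero, fun _ _ h => absurd h hP⟩
  choose f hf hfQ using hex
  let S := D.support.filter fun P => P.1 ∈ U.torus
  refine ⟨∏ P ∈ S, f P ^ D P, Finset.prod_ne_zero_iff.2 fun P _ => zpow_ne_zero _ (hf P), ?_⟩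
  intro Q hQ
  rw [ord_prod _ _ _ fun P _ => zpow_ne_zero _ (hf P)]
  have : ∀ P ∈ S, ord (f P ^ D P) Q.1 = if Q = P then D P else 0 := by
    intro P hP
    rw [ord_zpow _ (hf P), hfQ P Q hQ (Finset.mem_filter.1 hP).2]
    split_ifs <;> simp
  rw [Finset.sum_congr rfl this, Finset.sum_ite_eq]
  split_ifs with hQS
  · rfl
  · by_contra h
    exact hQS (Finset.mem_filter.2 ⟨Finsupp.mem_support_iff.2 fun h' => h h'.symm, hQ⟩)

theorem fg_H0 (c : Multiplicative M →* kˣ)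
    (hc : ∀ N, 0 < N → Function.Injective fun m => c m ^ N) (D : WeilDivisor U.scheme) :
    D.H0.FG := by
  classical
  obtain ⟨h, hh, hhD⟩ := exists_ord_eq D
  -- This is `D - div h`, which vanishes on the torus; the case distinction makes its finite support
  -- evident.
  let D' : WeilDivisor U.scheme := Finsupp.ofSupportFinite
    (fun P => if P.1 ∈ U.torus then 0 else D P - ord h P.1) (by
      refine Set.Finite.subset (U.finite_boundary.preimage Subtype.val_injective.injOn) ?_
      intro P hP
      exact ⟨P.2, fun hP' => hP (if_pos hP')⟩)
  have hD' : ∀ P : PrimeDivisor U.scheme, D' P = D P - ord h P.1 := by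
    intro P
    change (if P.1 ∈ U.torus then 0 else D P - ord h P.1) = _
    split_ifs with hP
    · rw [hhD P hP, sub_self]
    · rfl
  have hfg := fg_H0_of_forall_mem_torus c hc (D := D') fun P hP => by
    rw [hD', hhD P hP, sub_self]
  have hmap : D.H0 = D'.H0.map (LinearMap.mulLeft Γ(U.scheme, ⊤) h⁻¹) := by
    ext f
    constructor
    · intro hf
      refine ⟨h * f, mem_H0_iff.2 fun hf0 P => ?_, by simp [hh]⟩
      have hf1 : f ≠ 0 := right_ne_zero_of_mul hf0
      have := mem_H0_iff.1 hf hf1 P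
      rw [ord_mul hh hf1, hD']
      omega
    · rintro ⟨g, hg, rfl⟩
      refine mem_H0_iff.2 fun hg0 P => ?_
      rw [LinearMap.mulLeft_apply] at hg0 ⊢
      have hg1 : g ≠ 0 := right_ne_zero_of_mul hg0
      have := mem_H0_iff.1 hg hg1 P
      rw [hD'] at this
      rw [ord_mul (inv_ne_zero hh) hg1, ord_inv]
      omega
  rw [hmap]
  exact hfg.map _

end ToricVariety

theorem proposition4p4 (M : Type) [AddCommGroup M] [Module.Free ℤ M] [Module.Finite ℤ M]
    (U : ToricVariety ℝ M) (D : WeilDivisor U.scheme) :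
    Module.Finite Γ(U.scheme, ⊤) (WeilDivisor.H0 D) := by
  -- A real point of the torus no power of which satisfies a relation between characters.
  obtain ⟨θ, hθ⟩ := exists_injective_addMonoidHom_real M
  let c : Multiplicative M →* ℝˣ :=
    { toFun := fun m => Units.mk0 (Real.exp (θ m.toAdd)) (Real.exp_ne_zero _)
      map_one' := by ext; simp
      map_mul' := fun m n => by ext; simp [Real.exp_add] }
  rw [Module.Finite.iff_fg]
  refine ToricVariety.fg_H0 c (fun N hN m n hmn => ?_) D
  have h1 : Real.exp (θ m.toAdd) ^ N = Real.exp (θ n.toAdd) ^ N := congrArg Units.val hmn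
  have h2 := (pow_left_inj₀ (Real.exp_pos _).le (Real.exp_pos _).le hN.ne').1 h1
  exact Multiplicative.toAdd.injective (hθ (Real.exp_injective h2))
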